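/- Let $k$ be a field and let $(\mathcal C,\otimes,I,C)$ be a braided monoidal category with equalizers, equipped with a faithful strong monoidal ("forgetful") functor $F:\mathcal C\to{}_k\mathcal M$ to $k$-vector spaces, so $F(U\otimes V)\cong F(U)\otimes F(V)$, $F(I)\cong k$; $F$ need not respect the braidings. Elements of an object $U$ are elements of $F(U)$. (Associativity and unit constraints are suppressed, and the identity of $U$ is written $U$.) Let $H$ be a Hopf algebra in $\mathcal C$ with structure $m,\eta,\Delta,\epsilon,S$ and $C_{H,H}=C_{H,H}^{-1}$. Let $H^d$ be a faithful quasi-dual of $H$ with $H^d\subseteq H^*$. That is, $H^d$ is an algebra in $\mathcal C$ with a morphism $\langle\,,\rangle:H^d\otimes H\to I$ such that $$\langle\,,\rangle(m\otimes H)=(\langle\,,\rangle\otimes\langle\,,\rangle)(H^d\otimes C_{H^d,H}\otimes H)(H^d\otimes H^d\otimes\Delta),\qquad \langle\,,\rangle(\eta\otimes H)=\epsilon;$$ for all objects $U,V$, a morphism $f:U\to V\otimes H^d$ is determined by $(V\otimes\langle\,,\rangle)(f\otimes H)$ and a morphism $g:U\to H\otimes V$ is determined by $(\langle\,,\rangle\otimes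 V)(H^d\otimes g)$; and the induced linear map $F(H^d)\to F(H)^*=\mathrm{Hom}_k(F(H),k)$ is injective. A left $H^d$-module $(M,\alpha)$ in $\mathcal C$ is rational if there is a morphism $\rho:M\to M\otimes H$ with $(M\otimes\langle\,,\rangle)(C_{H^d,M}\otimes H)(H^d\otimes\rho)=\alpha$. Assume that the regular left module $H^d$ has a maximal rational submodule $i:H^{d\,rat}\to H^d$ in $\mathcal C$ (submodules are given by monomorphisms of $\mathcal C$ that are module maps; maximal means that $H^{d\,rat}$ is rational and every rational submodule factors through $i$), with $\rho:H^{d\,rat}\to H^{d\,rat}\otimes H$ as above. Assume that there is a morphism $\rightharpoonup:H\otimes H^d\to H^d$ in $\mathcal C$ with $$\langle\,,\rangle(\rightharpoonup\otimes H)=\langle\,,\rangle(H^d\otimes m)(H^d\otimes C_{H,H})(C_{H,H^d}\otimes H),$$ and that it restricts to a morphism $H\otimes H^{d\,rat}\to H^{d\,rat}$ in $\mathcal C$. Then $H^{d\,rat}$, with the action $\leftharpoondown\;=\;\rightharpoonup(S\otimes H^{d\,rat})C_{H^{d\,rat},H}$ and the coaction $\rho$, is a right $H$-Hopf module in $\mathcal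 C$, the object of left integrals $\int^l_{H^d}$ exists in $\mathcal C$, and $$H^{d\,rat}\cong\int^l_{H^d}\otimes H\qquad\text{as right $H$-Hopf modules in }\mathcal C,$$ where $\int^l_{H^d}\otimes H$ carries the action $\int^l_{H^d}\otimes m$ and the coaction $\int^l_{H^d}\otimes\Delta$. Here $\int^l_{H^d}$ is the set $\{f\in H^d\mid g*f=g(1)f\text{ for every }g\in H^d\}$ regarded in $\mathcal C$, i.e. the greatest subobject of $H^d$ in $\mathcal C$ all of whose elements lie in this set ($*$ is the product of $H^d$ and $g(1)=\langle g,1_H\rangle$). If this set is the image of $F(t)$ for some morphism $t:T\to H^d$ of $\mathcal C$ with $F(t)$ injective, then it is the image of $F(\int^l_{H^d})\to F(H^d)$. A right $H$-Hopf module is a right $H$-module $(X,a)$ and right $H$-comodule $(X,c)$ in $\mathcal C$ with $c\,a=(a\otimes m)(X\otimes C_{H,H}\otimes H)(c\otimes\Delta)$. -/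

import Mathlib

open CategoryTheory MonoidalCategory MonObj ComonObj HopfObj BraidedCategory
open scoped TensorProduct

universe w v u

namespace BraidedIntegral

section Categorical

variable {C : Type u} [Category.{v} C] [MonoidalCategory C] [BraidedCategory C]

/-- `N` is a left quasi-dual of the braided Hopf algebra `H` under `p = ⟨ , ⟩ : N ⊗ H ⟶ 𝟙`:
`⟨ , ⟩ (m ⊗ H) = (⟨ , ⟩ ⊗ ⟨ , ⟩)(N ⊗ C_{N,H} ⊗ H)(N ⊗ N ⊗ Δ)` and `⟨η, H⟩ = ε`. -/
structure IsQuasiDual (H N : C) [HopfObj H] [MonObj N] (p : N ⊗ H ⟶ 𝟙_ C) : Prop where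
  mul_pair : μ[N] ▷ H ≫ p =
    (N ⊗ N) ◁ Δ[H] ≫ tensorμ N N H H ≫ (p ⊗ₘ p) ≫ (λ_ (𝟙_ C)).hom
  one_pair : η[N] ▷ H ≫ p = (λ_ H).hom ≫ ε[H]

/-- `N` is a faithful quasi-dual of `H` under `p`. -/
structure IsFaithfulQuasiDual (H N : C) [HopfObj H] [MonObj N] (p : N ⊗ H ⟶ 𝟙_ C) : Prop
    extends IsQuasiDual H N p where
  faithful_left : ∀ {U V : C} (f f' : U ⟶ V ⊗ N),
    f ▷ H ≫ (α_ V N H).hom ≫ V ◁ p = f' ▷ H ≫ (α_ V N H).hom ≫ V ◁ p → f = f'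
  faithful_right : ∀ {U V : C} (g g' : U ⟶ H ⊗ V),
    N ◁ g ≫ (α_ N H V).inv ≫ p ▷ V = N ◁ g' ≫ (α_ N H V).inv ≫ p ▷ V → g = g'

/-- `(M, a)` is a left module over the algebra `A`. -/
structure IsLeftModule (A M : C) [MonObj A] (a : A ⊗ M ⟶ M) : Prop where
  one_act : η[A] ▷ M ≫ a = (λ_ M).hom
  mul_act : μ[A] ▷ M ≫ a = (α_ A A M).hom ≫ A ◁ a ≫ a

/-- Module-comodule compatibility of `a : N ⊗ M ⟶ M` and `r : M ⟶ M ⊗ H`: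
`(M ⊗ ⟨ , ⟩)(C_{N,M} ⊗ H)(N ⊗ r) = a`. -/
def MCOM {H N M : C} (p : N ⊗ H ⟶ 𝟙_ C) (a : N ⊗ M ⟶ M) (r : M ⟶ M ⊗ H) : Prop :=
  N ◁ r ≫ (α_ N M H).inv ≫ (β_ N M).hom ▷ H ≫ (α_ M N H).hom ≫ M ◁ p ≫ (ρ_ M).hom = a

/-- `j : M ⟶ N` exhibits `(M, a)` as a submodule in `C` of the regular left module `N`, and this
submodule is rational by means of `r : M ⟶ M ⊗ H`. -/
structure IsRationalSubmodule {H N M : C} [MonObj N] (p : N ⊗ H ⟶ 𝟙_ C)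
    (j : M ⟶ N) (a : N ⊗ M ⟶ M) (r : M ⟶ M ⊗ H) : Prop where
  mono : Mono j
  isLeftModule : IsLeftModule N M a
  act_comp : a ≫ j = N ◁ j ≫ μ[N]
  mcom : MCOM p a r

/-- `i : R ⟶ N`, with `a` and `r`, is the maximal rational submodule of the regular module `N`:
it is a rational submodule and contains all rational submodules. -/
structure IsMaximalRationalSubmodule {H N R : C} [MonObj N] (p : N ⊗ H ⟶ 𝟙_ C)
    (i : R ⟶ N) (a : N ⊗ R ⟶ R) (r : R ⟶ R ⊗ H) : Prop
    extends IsRationalSubmodule p i a r where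
  greatest : ∀ {U : C} (j : U ⟶ N) (b : N ⊗ U ⟶ U) (s : U ⟶ U ⊗ H),
    IsRationalSubmodule p j b s → ∃ t : U ⟶ R, t ≫ i = j

/-- `l : H ⊗ N ⟶ N` is the action `⇀`:
`⟨ , ⟩ (⇀ ⊗ H) = ⟨ , ⟩ (N ⊗ m)(N ⊗ C_{H,H})(C_{H,N} ⊗ H)`. -/
def IsHit {H N : C} [HopfObj H] (p : N ⊗ H ⟶ 𝟙_ C) (l : H ⊗ N ⟶ N) : Prop :=
  l ▷ H ≫ p =
    (β_ H N).hom ▷ H ≫ (α_ N H H).hom ≫ N ◁ (β_ H H).hom ≫ N ◁ μ[H] ≫ p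

/-- The right action `↼ = ⇀ (S ⊗ R) C_{R,H}` obtained from `l : H ⊗ R ⟶ R`. -/
def antipodeAction {H R : C} [HopfObj H] (l : H ⊗ R ⟶ R) : R ⊗ H ⟶ R :=
  (β_ R H).hom ≫ 𝒮[H] ▷ R ≫ l

/-- `(X, a, c)` is a (right) `H`-Hopf module in `C`: a right module, a right comodule, and
`c a = (a ⊗ m)(X ⊗ C_{H,H} ⊗ H)(c ⊗ Δ)`. -/
structure IsHopfModule (H X : C) [HopfObj H] (a : X ⊗ H ⟶ X) (c : X ⟶ X ⊗ H) : Prop where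
  act_one : X ◁ η[H] ≫ a = (ρ_ X).hom
  act_mul : a ▷ H ≫ a = (α_ X H H).hom ≫ X ◁ μ[H] ≫ a
  coact_counit : c ≫ X ◁ ε[H] = (ρ_ X).inv
  coact_comul : c ≫ X ◁ Δ[H] = c ≫ c ▷ H ≫ (α_ X H H).hom
  act_coact : a ≫ c = (c ⊗ₘ Δ[H]) ≫ tensorμ X H H H ≫ (a ⊗ₘ μ[H])

/-- The action `V ⊗ m` on `V ⊗ H`. -/
def freeAct (H V : C) [HopfObj H] : (V ⊗ H) ⊗ H ⟶ V ⊗ H :=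
  (α_ V H H).hom ≫ V ◁ μ[H]

/-- The coaction `V ⊗ Δ` on `V ⊗ H`. -/
def freeCoact (H V : C) [HopfObj H] : V ⊗ H ⟶ (V ⊗ H) ⊗ H :=
  V ◁ Δ[H] ≫ (α_ V H H).inv

end Categorical

section Elements

variable {k : Type w} [Field k] {C : Type u} [Category.{v} C] [MonoidalCategory C]
  (F : C ⥤ ModuleCat.{w} k) [F.Monoidal]

/-- The `k`-linear map from (the vector space of) `N` to the dual space `H^*` given by `p`. -/
noncomputable def toDual {H N : C} (p : N ⊗ H ⟶ 𝟙_ C) :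
    F.obj N →ₗ[k] Module.Dual k (F.obj H) :=
  TensorProduct.curry
    (Functor.LaxMonoidal.μ F N H ≫ F.map p ≫ Functor.OplaxMonoidal.η F).hom

/-- The unit element of an algebra in `C`. -/
noncomputable def oneElt (A : C) [MonObj A] : F.obj A :=
  (Functor.LaxMonoidal.ε F ≫ F.map η[A]).hom (1 : k)

/-- The product of two elements of an algebra in `C`. -/
noncomputable def mulElt {A : C} [MonObj A] (x y : F.obj A) : F.obj A :=
  (Functor.LaxMonoidal.μ F A A ≫ F.map μ[A]).hom (x ⊗ₜ[k] y)

/-- The set of left integrals `{f ∈ N | g * f = g(1) f for every g ∈ N}`. -/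
def leftIntegrals {H N : C} [MonObj H] [MonObj N] (p : N ⊗ H ⟶ 𝟙_ C) : Set (F.obj N) :=
  {f | ∀ g : F.obj N, mulElt F g f = toDual F p g (oneElt F H) • f}

/-- `e : J ⟶ N` is the space of left integrals as an object of `C`: the greatest subobject of `N`
in `C` all of whose elements are left integrals. -/
structure IsIntegralObject {H N J : C} [MonObj H] [MonObj N] (p : N ⊗ H ⟶ 𝟙_ C)
    (e : J ⟶ N) : Prop where
  mono : Mono e
  range_subset : Set.range (F.map e).hom ⊆ leftIntegrals F p
  greatest : ∀ {U : C} (f : U ⟶ N), Mono f →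
    Set.range (F.map f).hom ⊆ leftIntegrals F p → ∃ t : U ⟶ J, t ≫ e = f

end Elements

end BraidedIntegral

/-!
The pairing turns an `H`-coaction `ρ` on `M` into an `H^d`-action by contraction,
`n ⊗ (m ⊗ h) ↦ ⟨n, h⟩ m`, and by faithfulness `ρ` is recovered from this action, so the module
axioms of `H^{d rat}` become comodule axioms for `ρ`.

For the Hopf module compatibility both sides are contracted again, after embedding `H^{d rat}` in
`H^d`. Rationality of the regular action becomes `⟨f₀, x⟩ f₁ = ⟨f, x₂⟩ x₁`, while
`⟨f ↼ h, x⟩ = ⟨f, x S(h)⟩`, and the claim is reduced to the identity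
`x₁ ⊗ x₂ S(h) = y₁ h₂ ⊗ y₂` with `y = x S(h₁)`. It holds because `x ⊗ h ↦ x S(h₁) ⊗ h₂` is a section
of the Galois map `x ⊗ h ↦ x h₁ ⊗ h₂`, which composed with `x ⊗ h ↦ x₁ ⊗ x₂ S(h)` gives
`x ⊗ h ↦ x₁ h ⊗ x₂`.

By the fundamental theorem of Hopf modules, `H^{d rat}` is free on the image of the idempotent
`f ↦ f₀ S(f₁)`, which is the object of coinvariants. A morphism to `H^{d rat}` is coinvariant if and
only if it is a left integral as a morphism to `H^d`, and a monomorphism `U ⟶ H^d` that is a left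
integral is a rational submodule with the trivial coaction, so it factors through `H^{d rat}`.
-/

namespace BraidedIntegral

section Contraction

variable {C : Type u} [Category.{v} C] [MonoidalCategory C] [BraidedCategory C] {H N : C}

/-- Contraction `n ⊗ (v ⊗ h) ↦ ⟨n, h⟩ v` -/
def contract (p : N ⊗ H ⟶ 𝟙_ C) (V : C) : N ⊗ (V ⊗ H) ⟶ V :=
  (α_ N V H).inv ≫ (β_ N V).hom ▷ H ≫ (α_ V N H).hom ≫ V ◁ p ≫ (ρ_ V).hom

theorem contract_eq (p : N ⊗ H ⟶ 𝟙_ C) (V : C) :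
    contract p V = N ◁ (β_ H V).inv ≫ (α_ N H V).inv ≫ p ▷ V ≫ (λ_ V).hom := by
  have h := braiding_naturality_left p V
  simp only [braiding_tensor_left_hom, braiding_tensorUnit_left, Category.assoc] at h
  rw [contract, ← cancel_epi (N ◁ (β_ H V).hom), ← cancel_epi (α_ N H V).hom,
    ← cancel_mono (ρ_ V).inv]
  simpa using h.symm

theorem contract_braiding_inv (p : N ⊗ H ⟶ 𝟙_ C) (V : C) :
    (α_ N V H).inv ≫ (β_ V N).inv ▷ H ≫ (α_ V N H).hom ≫ V ◁ p ≫ (ρ_ V).hom =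
      N ◁ (β_ V H).hom ≫ (α_ N H V).inv ≫ p ▷ V ≫ (λ_ V).hom := by
  have h := braiding_inv_naturality_left p V
  simp only [braiding_tensor_right_inv, braiding_inv_tensorUnit_right, Category.assoc] at h
  rw [← cancel_epi (N ◁ (β_ V H).inv), ← cancel_epi (α_ N H V).hom, ← cancel_mono (ρ_ V).inv]
  simpa using h.symm

theorem whiskerRight_contract (p : N ⊗ H ⟶ 𝟙_ C) {V W : C} (f : V ⟶ W) :
    N ◁ f ▷ H ≫ contract p W = contract p V ≫ f := by
  rw [contract_eq, contract_eq, ← whiskerLeft_comp_assoc, braiding_inv_naturality_left,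
    whiskerLeft_comp_assoc, associator_inv_naturality_right_assoc, whisker_exchange_assoc,
    leftUnitor_naturality]
  simp only [Category.assoc]

theorem contract_tensor (p : N ⊗ H ⟶ 𝟙_ C) (V W : C) :
    contract p (V ⊗ W) = N ◁ ((α_ V W H).hom ≫ V ◁ (β_ H W).inv ≫ (α_ V H W).inv) ≫
      (α_ N (V ⊗ H) W).inv ≫ contract p V ▷ W := by
  simp only [contract_eq, braiding_tensor_right_inv]
  monoidal

theorem contract_tensor_right (p : N ⊗ H ⟶ 𝟙_ C) (V W : C) :
    contract p (V ⊗ W) = N ◁ (α_ V W H).hom ≫ (α_ N V (W ⊗ H)).inv ≫ (β_ N V).hom ▷ (W ⊗ H) ≫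
      (α_ V N (W ⊗ H)).hom ≫ V ◁ contract p W := by
  simp only [contract, braiding_tensor_right_hom]
  monoidal

theorem contract_tensor_braiding_inv (p : N ⊗ H ⟶ 𝟙_ C) (V W : C) :
    contract p (V ⊗ W) ≫ (β_ W V).inv =
      N ◁ ((α_ V W H).hom ≫ (β_ (W ⊗ H) V).inv) ≫
        𝟙 _ ⊗≫ (β_ N W).hom ▷ (H ⊗ V) ⊗≫ W ◁ p ▷ V ⊗≫ 𝟙 _ := by
  calc
    _ = 𝟙 _ ⊗≫ N ◁ (β_ W V).inv ▷ H ⊗≫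
          ((β_ N W).hom ▷ (V ⊗ H) ≫ (W ⊗ N) ◁ (β_ H V).inv) ⊗≫ W ◁ p ▷ V ⊗≫ 𝟙 _ := by
      rw [← whiskerRight_contract, contract_tensor_right, contract_eq]
      monoidal
    _ = _ := by
      rw [← whisker_exchange, braiding_tensor_left_inv]
      monoidal

end Contraction

section QuasiDual

variable {C : Type u} [Category.{v} C] [MonoidalCategory C] [BraidedCategory C] {H N : C}
  [HopfObj H] [MonObj N] {p : N ⊗ H ⟶ 𝟙_ C}

theorem IsQuasiDual.one_contract (hp : IsQuasiDual H N p) (V : C) :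
    η[N] ▷ (V ⊗ H) ≫ contract p V = (λ_ (V ⊗ H)).hom ≫ V ◁ ε[H] ≫ (ρ_ V).hom := by
  calc
    _ = (λ_ (V ⊗ H)).hom ≫ (β_ H V).inv ≫ (λ_ (H ⊗ V)).inv ≫ (α_ _ _ _).inv ≫
          (η[N] ▷ H ≫ p) ▷ V ≫ (λ_ V).hom := by
      rw [contract_eq, ← whisker_exchange_assoc]
      monoidal
    _ = (λ_ (V ⊗ H)).hom ≫ ((β_ H V).inv ≫ ε[H] ▷ V) ≫ (λ_ V).hom := by
      rw [hp.one_pair]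
      monoidal
    _ = _ := by
      rw [← braiding_inv_naturality_right, braiding_inv_tensorUnit_left]
      simp

theorem IsQuasiDual.contract_contract (hp : IsQuasiDual H N p) (V : C) :
    N ◁ (N ◁ (V ◁ Δ[H] ≫ (α_ V H H).inv) ≫ contract p (V ⊗ H)) ≫ contract p V =
      (α_ N N (V ⊗ H)).inv ≫ μ[N] ▷ (V ⊗ H) ≫ contract p V := by
  calc
    _ = N ◁ (N ◁ (V ◁ Δ[H] ≫ (α_ V H H).inv) ≫ contract p (V ⊗ H) ≫ (β_ H V).inv) ≫
          (α_ N H V).inv ≫ p ▷ V ≫ (λ_ V).hom := by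
      rw [contract_eq p V]
      monoidal
    _ = 𝟙 _ ⊗≫ N ◁ N ◁ ((β_ H V).inv ≫ Δ[H] ▷ V) ⊗≫ N ◁ (β_ N H).hom ▷ (H ⊗ V) ⊗≫
          ((N ⊗ H) ◁ p ≫ p ▷ 𝟙_ C) ▷ V ⊗≫ 𝟙 _ := by
      rw [contract_tensor_braiding_inv, ← braiding_inv_naturality_right]
      monoidal
    _ = (α_ N N (V ⊗ H)).inv ≫ (N ⊗ N) ◁ (β_ H V).inv ≫ (α_ (N ⊗ N) H V).inv ≫
          (μ[N] ▷ H ≫ p) ▷ V ≫ (λ_ V).hom := by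
      rw [hp.mul_pair, tensorμ, tensorHom_def']
      monoidal
    _ = _ := by
      rw [contract_eq, ← whisker_exchange_assoc]
      monoidal

end QuasiDual

section Faithful

variable {C : Type u} [Category.{v} C] [MonoidalCategory C] [BraidedCategory C] {H N : C}
  [HopfObj H] [MonObj N] {p : N ⊗ H ⟶ 𝟙_ C}

namespace IsFaithfulQuasiDual

theorem hom_ext (hp : IsFaithfulQuasiDual H N p) {U : C} {f f' : U ⟶ N}
    (h : f ▷ H ≫ p = f' ▷ H ≫ p) : f = f' := by
  have key (g : U ⟶ N) :
      (g ≫ (λ_ N).inv) ▷ H ≫ (α_ (𝟙_ C) N H).hom ≫ 𝟙_ C ◁ p = (g ▷ H ≫ p) ≫ (λ_ (𝟙_ C)).inv := by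
    monoidal
  rw [← cancel_mono (λ_ N).inv]
  exact hp.faithful_left _ _ (by rw [key, key, h])

theorem hom_ext_contract (hp : IsFaithfulQuasiDual H N p) {U V : C} {g g' : U ⟶ V ⊗ H}
    (h : N ◁ g ≫ contract p V = N ◁ g' ≫ contract p V) : g = g' := by
  rw [← cancel_mono (β_ H V).inv]
  apply hp.faithful_right
  rw [← cancel_mono (λ_ V).hom]
  simpa only [contract_eq, whiskerLeft_comp, Category.assoc] using h

theorem mono_whiskerRight (hp : IsFaithfulQuasiDual H N p) {V W : C} (i : V ⟶ W) [Mono i] :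
    Mono (i ▷ H) where
  right_cancellation g g' h := hp.hom_ext_contract <| by
    rw [← cancel_mono i, Category.assoc, Category.assoc, ← whiskerRight_contract,
      ← whiskerLeft_comp_assoc, ← whiskerLeft_comp_assoc, h]

theorem braiding_eq_inv (hp : IsFaithfulQuasiDual H N p) (hs : (β_ H H).hom = (β_ H H).inv) :
    (β_ N H).hom = (β_ H N).inv := by
  apply hp.faithful_left
  rw [← cancel_epi (α_ N H H).inv, ← cancel_mono (ρ_ H).hom]
  simp only [Category.assoc]
  rw [contract_braiding_inv, hs, ← contract_eq, contract]

theorem hom_ext_tensor (hp : IsFaithfulQuasiDual H N p) {U : C} {f f' : U ⟶ N ⊗ H}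
    (h : f ▷ H ≫ (α_ N H H).hom ≫ contract p H = f' ▷ H ≫ (α_ N H H).hom ≫ contract p H) :
    f = f' := by
  rw [← cancel_mono (β_ N H).hom]
  apply hp.faithful_left
  rw [← cancel_mono (ρ_ H).hom]
  simpa [contract] using h

end IsFaithfulQuasiDual

end Faithful

section RationalComodule

variable {C : Type u} [Category.{v} C] [MonoidalCategory C] [BraidedCategory C] {H N M : C}
  [HopfObj H] [MonObj N] {p : N ⊗ H ⟶ 𝟙_ C} {a : N ⊗ M ⟶ M} {r : M ⟶ M ⊗ H}

theorem MCOM.coact_counit (hr : MCOM p a r) (hp : IsQuasiDual H N p) (ha : IsLeftModule N M a) :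
    r ≫ M ◁ ε[H] = (ρ_ M).inv := by
  rw [← cancel_mono (ρ_ M).hom, ← cancel_epi (λ_ M).hom, Category.assoc]
  calc
    _ = 𝟙_ C ◁ r ≫ (λ_ (M ⊗ H)).hom ≫ M ◁ ε[H] ≫ (ρ_ M).hom := by simp
    _ = η[N] ▷ M ≫ N ◁ r ≫ contract p M := by
      rw [← hp.one_contract, whisker_exchange_assoc]
    _ = η[N] ▷ M ≫ a := congrArg _ hr
    _ = _ := by rw [ha.one_act, Iso.inv_hom_id, Category.comp_id]

theorem MCOM.coact_comul (hr : MCOM p a r) (hp : IsFaithfulQuasiDual H N p)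
    (ha : IsLeftModule N M a) :
    r ≫ M ◁ Δ[H] = r ≫ r ▷ H ≫ (α_ M H H).hom := by
  have hr' : N ◁ r ≫ contract p M = a := hr
  rw [← cancel_mono (α_ M H H).inv]
  refine hp.hom_ext_contract (hp.hom_ext_contract ?_)
  calc
    _ = N ◁ N ◁ r ≫ N ◁ (N ◁ (M ◁ Δ[H] ≫ (α_ M H H).inv) ≫ contract p (M ⊗ H)) ≫ contract p M := by
      simp
    _ = (α_ N N M).inv ≫ μ[N] ▷ M ≫ N ◁ r ≫ contract p M := by
      rw [hp.contract_contract, ← whisker_exchange_assoc]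
      monoidal
    _ = (α_ N N M).inv ≫ μ[N] ▷ M ≫ a := by rw [hr']
    _ = N ◁ (N ◁ r ≫ contract p M) ≫ N ◁ r ≫ contract p M := by
      rw [ha.mul_act, Iso.inv_hom_id_assoc, hr']
    _ = N ◁ (N ◁ r ≫ N ◁ r ▷ H ≫ contract p (M ⊗ H)) ≫ contract p M := by
      rw [whiskerRight_contract]
      simp
    _ = _ := by simp

end RationalComodule

section Pairing

variable {C : Type u} [Category.{v} C] [MonoidalCategory C] [BraidedCategory C] {H N M : C}
  [HopfObj H] [MonObj N] {p : N ⊗ H ⟶ 𝟙_ C}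

theorem IsFaithfulQuasiDual.hom_ext_pair (hp : IsFaithfulQuasiDual H N p) {U : C} {g g' : U ⟶ H}
    (h : N ◁ g ≫ p = N ◁ g' ≫ p) : g = g' := by
  have key (f : U ⟶ H) :
      N ◁ (f ≫ (ρ_ H).inv) ≫ (α_ N H (𝟙_ C)).inv ≫ p ▷ 𝟙_ C = (N ◁ f ≫ p) ≫ (ρ_ (𝟙_ C)).inv := by
    monoidal
  rw [← cancel_mono (ρ_ H).inv]
  exact hp.faithful_right _ _ (by rw [key, key, h])

theorem IsQuasiDual.comul_contract_pair (hp : IsQuasiDual H N p) :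
    N ◁ (N ◁ Δ[H] ≫ contract p H) ≫ p = (α_ N N H).inv ≫ μ[N] ▷ H ≫ p := by
  rw [hp.mul_pair, tensorμ, tensorHom_def', contract]
  monoidal

theorem IsFaithfulQuasiDual.contract_pair (hp : IsFaithfulQuasiDual H N p)
    (hs : (β_ H H).hom = (β_ H H).inv) :
    contract p N ▷ H ≫ p =
      (α_ N (N ⊗ H) H).hom ≫ N ◁ ((α_ N H H).hom ≫ contract p H) ≫ p := by
  calc
    _ = 𝟙 _ ⊗≫ N ◁ (β_ H N).inv ▷ H ⊗≫ (p ▷ (N ⊗ H) ≫ 𝟙_ C ◁ p) ⊗≫ 𝟙 _ := by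
      rw [contract_eq]
      monoidal
    _ = 𝟙 _ ⊗≫ N ◁ (β_ N H).hom ▷ H ⊗≫ ((N ⊗ H) ◁ p ≫ p ▷ 𝟙_ C) ⊗≫ 𝟙 _ := by
      rw [hp.braiding_eq_inv hs, whisker_exchange]
    _ = _ := by
      rw [contract]
      monoidal

theorem IsRationalSubmodule.coact_contract {i : M ⟶ N} {a : N ⊗ M ⟶ M} {r : M ⟶ M ⊗ H}
    (hM : IsRationalSubmodule p i a r) (hp : IsFaithfulQuasiDual H N p)
    (hs : (β_ H H).hom = (β_ H H).inv) :
    (r ≫ i ▷ H) ▷ H ≫ (α_ N H H).hom ≫ contract p H = i ▷ H ≫ N ◁ Δ[H] ≫ contract p H := by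
  have hr : N ◁ r ≫ contract p M = a := hM.mcom
  apply hp.hom_ext_pair
  calc
    _ = (α_ N M H).inv ≫ (N ◁ r ≫ N ◁ i ▷ H) ▷ H ≫ (α_ N (N ⊗ H) H).hom ≫
          N ◁ ((α_ N H H).hom ≫ contract p H) ≫ p := by
      monoidal
    _ = (α_ N M H).inv ≫ ((N ◁ r ≫ contract p M) ≫ i) ▷ H ≫ p := by
      rw [← hp.contract_pair hs, Category.assoc, ← whiskerRight_contract]
      simp
    _ = (α_ N M H).inv ≫ (N ◁ i ≫ μ[N]) ▷ H ≫ p := by rw [hr, hM.act_comp]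
    _ = N ◁ i ▷ H ≫ N ◁ (N ◁ Δ[H] ≫ contract p H) ≫ p := by
      rw [hp.comul_contract_pair]
      monoidal
    _ = _ := by monoidal

end Pairing

section Action

variable {C : Type u} [Category.{v} C] [MonoidalCategory C] [BraidedCategory C] {H N M : C}
  [HopfObj H] [MonObj N] {p : N ⊗ H ⟶ 𝟙_ C}

/-- Right multiplication by the antipode, `x ⊗ h ↦ x S(h)` -/
def mulAntipode (H : C) [HopfObj H] : H ⊗ H ⟶ H := H ◁ 𝒮[H] ≫ μ[H]

theorem one_braiding_mulAntipode :
    η[H] ▷ H ≫ (β_ H H).hom ≫ mulAntipode H = (λ_ H).hom := by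
  rw [mulAntipode, braiding_naturality_left_assoc, ← whiskerLeft_comp_assoc, one_antipode]
  simp

theorem mul_braiding_mulAntipode :
    μ[H] ▷ H ≫ (β_ H H).hom ≫ mulAntipode H =
      (α_ H H H).hom ≫ H ◁ ((β_ H H).hom ≫ mulAntipode H) ≫ (β_ H H).hom ≫ mulAntipode H := by
  calc
    _ = (β_ (H ⊗ H) H).hom ≫ H ◁ (μ[H] ≫ 𝒮[H]) ≫ μ[H] := by
      rw [mulAntipode, braiding_naturality_left_assoc]
      simp
    _ = (β_ (H ⊗ H) H).hom ≫ H ◁ (β_ H H).hom ≫ H ◁ (𝒮[H] ⊗ₘ 𝒮[H]) ≫ (α_ H H H).inv ≫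
          μ[H] ▷ H ≫ μ[H] := by
      rw [mul_antipode, braiding_naturality_assoc]
      simp
    _ = 𝟙 _ ⊗≫ H ◁ (β_ H H).hom ⊗≫ (β_ H (H ⊗ H)).hom ⊗≫ H ◁ 𝒮[H] ▷ H ⊗≫
          ((H ⊗ H) ◁ 𝒮[H] ≫ μ[H] ▷ H) ≫ μ[H] := by
      rw [braiding_tensor_left_hom, braiding_tensor_right_hom,
        MonoidalCategory.tensorHom_def]
      monoidal
    _ = 𝟙 _ ⊗≫ H ◁ (β_ H H).hom ⊗≫ ((β_ H (H ⊗ H)).hom ≫ mulAntipode H ▷ H) ≫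
          mulAntipode H := by
      rw [whisker_exchange, mulAntipode]
      monoidal
    _ = _ := by
      rw [← braiding_naturality_right]
      monoidal

theorem antipodeAction_comp {R : C} {i : R ⟶ M} {l : H ⊗ M ⟶ M} {lR : H ⊗ R ⟶ R}
    (hlR : lR ≫ i = H ◁ i ≫ l) : antipodeAction lR ≫ i = i ▷ H ≫ antipodeAction l := by
  simp only [antipodeAction, Category.assoc]
  rw [hlR, ← whisker_exchange_assoc, braiding_naturality_left_assoc]

theorem IsFaithfulQuasiDual.antipodeAction_pair (hp : IsFaithfulQuasiDual H N p)
    (hs : (β_ H H).hom = (β_ H H).inv) {l : H ⊗ N ⟶ N} (hl : IsHit p l) :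
    antipodeAction l ▷ H ≫ p = (α_ N H H).hom ≫ N ◁ ((β_ H H).hom ≫ mulAntipode H) ≫ p := by
  calc
    _ = (β_ N H).hom ▷ H ≫ 𝒮[H] ▷ N ▷ H ≫ (l ▷ H ≫ p) := by simp [antipodeAction]
    _ = ((β_ N H).hom ≫ 𝒮[H] ▷ N ≫ (β_ H N).hom) ▷ H ≫ (α_ N H H).hom ≫
          N ◁ (β_ H H).hom ≫ N ◁ μ[H] ≫ p := by
      rw [hl]
      simp only [comp_whiskerRight, Category.assoc]
    _ = (N ◁ 𝒮[H]) ▷ H ≫ (α_ N H H).hom ≫ N ◁ (β_ H H).hom ≫ N ◁ μ[H] ≫ p := by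
      rw [braiding_naturality_left, hp.braiding_eq_inv hs, Iso.inv_hom_id_assoc]
    _ = (α_ N H H).hom ≫ N ◁ (𝒮[H] ▷ H ≫ (β_ H H).hom) ≫ N ◁ μ[H] ≫ p := by monoidal
    _ = _ := by
      rw [braiding_naturality_left, mulAntipode]
      monoidal

theorem IsFaithfulQuasiDual.antipodeAction_one (hp : IsFaithfulQuasiDual H N p)
    (hs : (β_ H H).hom = (β_ H H).inv) {l : H ⊗ N ⟶ N} (hl : IsHit p l) :
    N ◁ η[H] ≫ antipodeAction l = (ρ_ N).hom := by
  apply hp.hom_ext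
  calc
    _ = (α_ N (𝟙_ C) H).hom ≫ N ◁ (η[H] ▷ H ≫ (β_ H H).hom ≫ mulAntipode H) ≫ p := by
      rw [comp_whiskerRight, Category.assoc, hp.antipodeAction_pair hs hl]
      monoidal
    _ = _ := by
      rw [one_braiding_mulAntipode]
      simp

theorem IsFaithfulQuasiDual.antipodeAction_mul (hp : IsFaithfulQuasiDual H N p)
    (hs : (β_ H H).hom = (β_ H H).inv) {l : H ⊗ N ⟶ N} (hl : IsHit p l) :
    antipodeAction l ▷ H ≫ antipodeAction l = (α_ N H H).hom ≫ N ◁ μ[H] ≫ antipodeAction l := by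
  apply hp.hom_ext
  calc
    _ = (α_ (N ⊗ H) H H).hom ≫ (antipodeAction l ▷ (H ⊗ H) ≫ N ◁ ((β_ H H).hom ≫ mulAntipode H)) ≫
          p := by
      rw [comp_whiskerRight, Category.assoc, hp.antipodeAction_pair hs hl]
      simp
    _ = (α_ (N ⊗ H) H H).hom ≫ (N ⊗ H) ◁ ((β_ H H).hom ≫ mulAntipode H) ≫
          (antipodeAction l ▷ H ≫ p) := by
      rw [← whisker_exchange, Category.assoc]
    _ = (α_ N H H).hom ▷ H ≫ (α_ N (H ⊗ H) H).hom ≫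
          N ◁ (μ[H] ▷ H ≫ (β_ H H).hom ≫ mulAntipode H) ≫ p := by
      rw [mul_braiding_mulAntipode, hp.antipodeAction_pair hs hl]
      monoidal
    _ = _ := by
      rw [comp_whiskerRight, comp_whiskerRight, Category.assoc, Category.assoc,
        hp.antipodeAction_pair hs hl]
      monoidal

end Action

section Galois

variable {C : Type u} [Category.{v} C] [MonoidalCategory C] [BraidedCategory C]
  (H : C) [HopfObj H]

/-- The Galois map `x ⊗ h ↦ x h₁ ⊗ h₂` of `H` over `𝟙_ C` -/
def galoisMap : H ⊗ H ⟶ H ⊗ H :=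
  H ◁ Δ[H] ≫ (α_ H H H).inv ≫ μ[H] ▷ H

/-- The inverse `x ⊗ h ↦ x S(h₁) ⊗ h₂` of the Galois map -/
def galoisInv : H ⊗ H ⟶ H ⊗ H :=
  H ◁ Δ[H] ≫ (α_ H H H).inv ≫ mulAntipode H ▷ H

theorem galoisInv_galoisMap : galoisInv H ≫ galoisMap H = 𝟙 (H ⊗ H) := by
  calc
    _ = 𝟙 _ ⊗≫ H ◁ Δ[H] ⊗≫ (((H ◁ 𝒮[H]) ▷ H) ≫ (μ[H] ▷ H ≫ H ◁ Δ[H])) ⊗≫ μ[H] ▷ H := by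
      rw [galoisInv, galoisMap, mulAntipode]
      monoidal
    _ = 𝟙 _ ⊗≫ H ◁ (Δ[H] ≫ H ◁ Δ[H]) ⊗≫ (H ◁ 𝒮[H]) ▷ (H ⊗ H) ⊗≫ (μ[H] ▷ H ≫ μ[H]) ▷ H := by
      rw [← whisker_exchange (f := μ[H]), ← whisker_exchange_assoc (f := H ◁ 𝒮[H])]
      monoidal
    _ = 𝟙 _ ⊗≫ H ◁ Δ[H] ⊗≫ H ◁ (Δ[H] ≫ 𝒮[H] ▷ H ≫ μ[H]) ▷ H ⊗≫ μ[H] ▷ H := by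
      rw [MonObj.mul_assoc, ComonObj.comul_assoc]
      monoidal
    _ = 𝟙 _ ⊗≫ H ◁ (Δ[H] ≫ ε[H] ▷ H) ⊗≫ (H ◁ η[H] ≫ μ[H]) ▷ H := by
      rw [antipode_left]
      monoidal
    _ = _ := by
      rw [ComonObj.counit_comul, MonObj.mul_one]
      monoidal

/-- The action of `H` on the first leg of the coproduct, `x ⊗ h ↦ x₁ h ⊗ x₂` -/
def comulMul : H ⊗ H ⟶ H ⊗ H :=
  Δ[H] ▷ H ≫ (α_ H H H).hom ≫ H ◁ (β_ H H).hom ≫ (α_ H H H).inv ≫ μ[H] ▷ H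

/-- The action of `S(H)` on the second leg of the coproduct, `x ⊗ h ↦ x₁ ⊗ x₂ S(h)` -/
def comulMulAntipode : H ⊗ H ⟶ H ⊗ H :=
  Δ[H] ▷ H ≫ (α_ H H H).hom ≫ H ◁ mulAntipode H

theorem galoisMap_comulMulAntipode : galoisMap H ≫ comulMulAntipode H = comulMul H := by
  set b : H ⊗ (H ⊗ H) ⟶ H ⊗ H := H ◁ (β_ H H).hom ≫ (α_ H H H).inv ≫ μ[H] ▷ H with hb
  calc
    _ = 𝟙 _ ⊗≫ H ◁ Δ[H] ⊗≫ (μ[H] ≫ Δ[H]) ▷ H ⊗≫ H ◁ mulAntipode H := by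
      rw [galoisMap, comulMulAntipode]
      monoidal
    _ = 𝟙 _ ⊗≫ (H ◁ Δ[H] ≫ Δ[H] ▷ (H ⊗ H)) ⊗≫ (H ⊗ H) ◁ Δ[H] ▷ H ⊗≫ b ▷ (H ⊗ H) ⊗≫
          H ◁ ((μ[H] ▷ H ≫ H ◁ 𝒮[H]) ≫ μ[H]) := by
      rw [BimonObj.mul_comul, tensorμ, MonoidalCategory.tensorHom_def,
        MonoidalCategory.tensorHom_def, mulAntipode, hb]
      monoidal
    _ = 𝟙 _ ⊗≫ Δ[H] ▷ H ⊗≫ (H ⊗ H) ◁ (Δ[H] ≫ Δ[H] ▷ H) ⊗≫ b ▷ (H ⊗ H) ⊗≫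
          H ◁ (H ⊗ H) ◁ 𝒮[H] ⊗≫ H ◁ (μ[H] ▷ H ≫ μ[H]) := by
      rw [whisker_exchange Δ[H] Δ[H], ← whisker_exchange μ[H] 𝒮[H]]
      monoidal
    _ = 𝟙 _ ⊗≫ Δ[H] ▷ H ⊗≫ (H ⊗ H) ◁ Δ[H] ⊗≫ ((H ⊗ (H ⊗ H)) ◁ Δ[H] ≫ b ▷ (H ⊗ H)) ⊗≫
          (H ⊗ H) ◁ (H ◁ 𝒮[H] ≫ μ[H]) ⊗≫ H ◁ μ[H] := by
      rw [MonObj.mul_assoc, ComonObj.comul_assoc_flip]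
      monoidal
    _ = 𝟙 _ ⊗≫ Δ[H] ▷ H ⊗≫ (H ⊗ H) ◁ Δ[H] ⊗≫ b ▷ H ⊗≫
          (H ⊗ H) ◁ (Δ[H] ≫ H ◁ 𝒮[H] ≫ μ[H]) ⊗≫ H ◁ μ[H] := by
      rw [whisker_exchange]
      monoidal
    _ = 𝟙 _ ⊗≫ Δ[H] ▷ H ⊗≫ (H ⊗ H) ◁ Δ[H] ⊗≫ (b ▷ H ≫ (H ⊗ H) ◁ ε[H]) ⊗≫
          H ◁ (H ◁ η[H] ≫ μ[H]) := by
      rw [antipode_right]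
      monoidal
    _ = 𝟙 _ ⊗≫ Δ[H] ▷ H ⊗≫ (H ⊗ H) ◁ (Δ[H] ≫ H ◁ ε[H]) ⊗≫ b ⊗≫ 𝟙 _ := by
      rw [← whisker_exchange, MonObj.mul_one]
      monoidal
    _ = _ := by
      rw [ComonObj.comul_counit, comulMul, hb]
      monoidal

theorem galoisInv_comulMul : galoisInv H ≫ comulMul H = comulMulAntipode H := by
  rw [← galoisMap_comulMulAntipode, ← Category.assoc, galoisInv_galoisMap, Category.id_comp]

theorem comulMul_contract {N : C} (p : N ⊗ H ⟶ 𝟙_ C) :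
    N ◁ comulMul H ≫ contract p H =
      (α_ N H H).inv ≫ (N ◁ Δ[H] ≫ contract p H) ▷ H ≫ μ[H] := by
  calc
    _ = N ◁ (Δ[H] ▷ H ≫ (α_ H H H).hom ≫ H ◁ (β_ H H).hom ≫ (α_ H H H).inv) ≫
          (N ◁ μ[H] ▷ H ≫ contract p H) := by
      simp [comulMul]
    _ = _ := by
      rw [whiskerRight_contract, contract_tensor]
      simp

end Galois

section Compatibility

variable {C : Type u} [Category.{v} C] [MonoidalCategory C] [BraidedCategory C] {H N R : C}
  [HopfObj H] [MonObj N] {p : N ⊗ H ⟶ 𝟙_ C}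

/-- The diagonal action `(x ⊗ h) · k = x k₁ ⊗ h k₂` of `H` on `X ⊗ H` -/
def diagAct {X : C} (a : X ⊗ H ⟶ X) : (X ⊗ H) ⊗ H ⟶ X ⊗ H :=
  (X ⊗ H) ◁ Δ[H] ≫ tensorμ X H H H ≫ (a ⊗ₘ μ[H])

theorem diagAct_comp {X Y : C} {a : X ⊗ H ⟶ X} {b : Y ⊗ H ⟶ Y} {f : X ⟶ Y}
    (hf : a ≫ f = f ▷ H ≫ b) : diagAct a ≫ f ▷ H = (f ▷ H) ▷ H ≫ diagAct b := by
  calc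
    _ = (X ⊗ H) ◁ Δ[H] ≫ tensorμ X H H H ≫ ((a ≫ f) ⊗ₘ μ[H]) := by
      simp only [diagAct, Category.assoc, tensorHom_comp_whiskerRight]
    _ = (X ⊗ H) ◁ Δ[H] ≫ (f ▷ H) ▷ (H ⊗ H) ≫ tensorμ Y H H H ≫ (b ⊗ₘ μ[H]) := by
      rw [hf, ← tensorHom_id f H, tensorμ_natural_left_assoc, id_whiskerRight,
        tensorHom_comp_tensorHom, Category.id_comp, tensorHom_id]
    _ = _ := by
      rw [diagAct, whisker_exchange_assoc]

theorem galoisInv_braiding (hs : (β_ H H).hom = (β_ H H).inv) :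
    H ◁ Δ[H] ▷ H ⊗≫ (β_ H H).hom ▷ (H ⊗ H) ⊗≫ H ◁ (β_ H (H ⊗ H)).inv ⊗≫
        ((β_ H H).hom ≫ mulAntipode H) ▷ (H ⊗ H) =
      H ◁ ((β_ H H).hom ≫ galoisInv H) ⊗≫ (β_ H H).inv ▷ H ⊗≫ 𝟙 _ := by
  calc
    _ = H ◁ Δ[H] ▷ H ⊗≫ ((β_ H H).hom ▷ (H ⊗ H) ≫ (H ⊗ H) ◁ (β_ H H).hom) ⊗≫
          H ◁ (β_ H H).hom ▷ H ⊗≫ (β_ H H).hom ▷ (H ⊗ H) ⊗≫ mulAntipode H ▷ (H ⊗ H) := by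
      rw [braiding_tensor_right_inv, ← hs]
      monoidal
    _ = H ◁ Δ[H] ▷ H ⊗≫ (H ⊗ H) ◁ (β_ H H).hom ⊗≫
          ((β_ H H).hom ▷ H ⊗≫ H ◁ (β_ H H).hom ⊗≫ (β_ H H).hom ▷ H) ▷ H ⊗≫
          mulAntipode H ▷ (H ⊗ H) := by
      rw [← whisker_exchange]
      monoidal
    _ = H ◁ (Δ[H] ▷ H ≫ (β_ (H ⊗ H) H).hom) ⊗≫
          ((β_ H (H ⊗ H)).hom ≫ mulAntipode H ▷ H) ▷ H ⊗≫ 𝟙 _ := by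
      rw [yang_baxter', braiding_tensor_left_hom, braiding_tensor_right_hom]
      monoidal
    _ = _ := by
      rw [braiding_naturality_left, ← braiding_naturality_right, galoisInv, ← hs]
      monoidal

theorem IsFaithfulQuasiDual.diagAct_contract (hp : IsFaithfulQuasiDual H N p)
    (hs : (β_ H H).hom = (β_ H H).inv) {l : H ⊗ N ⟶ N} (hl : IsHit p l) :
    diagAct (antipodeAction l) ▷ H ≫ (α_ N H H).hom ≫ contract p H =
      (α_ (N ⊗ H) H H).hom ≫ (N ⊗ H) ◁ ((β_ H H).hom ≫ galoisInv H) ≫ (α_ (N ⊗ H) H H).inv ≫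
        ((α_ N H H).hom ≫ contract p H) ▷ H ≫ μ[H] := by
  calc
    _ = 𝟙 _ ⊗≫ (N ⊗ H) ◁ Δ[H] ▷ H ⊗≫ N ◁ (β_ H H).hom ▷ (H ⊗ H) ⊗≫
          antipodeAction l ▷ ((H ⊗ H) ⊗ H) ⊗≫ (N ◁ μ[H] ▷ H ≫ contract p H) := by
      rw [diagAct, tensorμ, MonoidalCategory.tensorHom_def]
      monoidal
    _ = 𝟙 _ ⊗≫ (N ⊗ H) ◁ Δ[H] ▷ H ⊗≫ N ◁ (β_ H H).hom ▷ (H ⊗ H) ⊗≫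
          (antipodeAction l ▷ ((H ⊗ H) ⊗ H) ≫ N ◁ (β_ H (H ⊗ H)).inv) ⊗≫ p ▷ (H ⊗ H) ⊗≫ μ[H] := by
      rw [whiskerRight_contract, contract_eq]
      monoidal
    _ = 𝟙 _ ⊗≫ (N ⊗ H) ◁ Δ[H] ▷ H ⊗≫ N ◁ (β_ H H).hom ▷ (H ⊗ H) ⊗≫
          (N ⊗ H) ◁ (β_ H (H ⊗ H)).inv ⊗≫ (antipodeAction l ▷ H ≫ p) ▷ (H ⊗ H) ⊗≫ μ[H] := by
      rw [← whisker_exchange]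
      monoidal
    _ = 𝟙 _ ⊗≫ N ◁ (H ◁ Δ[H] ▷ H ⊗≫ (β_ H H).hom ▷ (H ⊗ H) ⊗≫
          H ◁ (β_ H (H ⊗ H)).inv ⊗≫ ((β_ H H).hom ≫ mulAntipode H) ▷ (H ⊗ H)) ⊗≫
          p ▷ (H ⊗ H) ⊗≫ μ[H] := by
      rw [hp.antipodeAction_pair hs hl]
      monoidal
    _ = _ := by
      rw [galoisInv_braiding hs, contract_eq]
      monoidal

theorem IsFaithfulQuasiDual.comul_contract_antipodeAction (hp : IsFaithfulQuasiDual H N p)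
    (hs : (β_ H H).hom = (β_ H H).inv) {l : H ⊗ N ⟶ N} (hl : IsHit p l) :
    antipodeAction l ▷ H ≫ N ◁ Δ[H] ≫ contract p H =
      (α_ N H H).hom ≫ N ◁ ((β_ H H).hom ≫ comulMulAntipode H) ≫ contract p H := by
  calc
    _ = (N ⊗ H) ◁ Δ[H] ⊗≫ (antipodeAction l ▷ H ≫ (β_ N H).hom) ▷ H ⊗≫ H ◁ p ⊗≫ 𝟙 _ := by
      rw [← whisker_exchange_assoc, contract]
      monoidal
    _ = (N ⊗ H) ◁ Δ[H] ⊗≫ (β_ (N ⊗ H) H).hom ▷ H ⊗≫ H ◁ (antipodeAction l ▷ H ≫ p) ⊗≫ 𝟙 _ := by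
      rw [braiding_naturality_left]
      monoidal
    _ = 𝟙 _ ⊗≫ N ◁ (H ◁ Δ[H] ⊗≫ (β_ H H).hom ▷ H) ⊗≫
          ((β_ N H).hom ▷ (H ⊗ H) ≫ (H ⊗ N) ◁ ((β_ H H).hom ≫ mulAntipode H)) ⊗≫
          H ◁ p ⊗≫ 𝟙 _ := by
      rw [hp.antipodeAction_pair hs hl, braiding_tensor_left_hom]
      monoidal
    _ = 𝟙 _ ⊗≫ N ◁ (H ◁ Δ[H] ≫ (β_ H (H ⊗ H)).hom) ⊗≫ (N ⊗ H) ◁ mulAntipode H ⊗≫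
          (β_ N H).hom ▷ H ⊗≫ H ◁ p ⊗≫ 𝟙 _ := by
      rw [← whisker_exchange, braiding_tensor_right_hom]
      monoidal
    _ = _ := by
      rw [braiding_naturality_right, comulMulAntipode, contract]
      monoidal

variable {i : R ⟶ N} {a : N ⊗ R ⟶ R} {r : R ⟶ R ⊗ H}

theorem IsRationalSubmodule.act_coact (hR : IsRationalSubmodule p i a r)
    (hp : IsFaithfulQuasiDual H N p) (hs : (β_ H H).hom = (β_ H H).inv)
    {l : H ⊗ N ⟶ N} (hl : IsHit p l) {lR : H ⊗ R ⟶ R} (hlR : lR ≫ i = H ◁ i ≫ l) :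
    antipodeAction lR ≫ r = r ▷ H ≫ diagAct (antipodeAction lR) := by
  have := hR.mono
  have := hp.mono_whiskerRight i
  rw [← cancel_mono (i ▷ H)]
  apply hp.hom_ext_tensor
  calc
    _ = (antipodeAction lR ≫ i) ▷ H ≫ N ◁ Δ[H] ≫ contract p H := by
      rw [comp_whiskerRight (antipodeAction lR) i, Category.assoc (antipodeAction lR ▷ H),
        ← hR.coact_contract hp hs]
      simp only [comp_whiskerRight, Category.assoc]
    _ = (α_ R H H).hom ≫ i ▷ (H ⊗ H) ≫ N ◁ ((β_ H H).hom ≫ comulMulAntipode H) ≫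
          contract p H := by
      rw [antipodeAction_comp hlR, comp_whiskerRight, Category.assoc,
        hp.comul_contract_antipodeAction hs hl]
      simp
    _ = (α_ R H H).hom ≫ i ▷ (H ⊗ H) ≫ N ◁ ((β_ H H).hom ≫ galoisInv H) ≫ (α_ N H H).inv ≫
          (N ◁ Δ[H] ≫ contract p H) ▷ H ≫ μ[H] := by
      rw [← galoisInv_comulMul, ← comulMul_contract H p]
      simp
    _ = (α_ R H H).hom ≫ R ◁ ((β_ H H).hom ≫ galoisInv H) ≫ (α_ R H H).inv ≫
          (i ▷ H ≫ N ◁ Δ[H] ≫ contract p H) ▷ H ≫ μ[H] := by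
      rw [← whisker_exchange_assoc]
      simp
    _ = (α_ R H H).hom ≫ (R ◁ ((β_ H H).hom ≫ galoisInv H) ≫ (r ≫ i ▷ H) ▷ (H ⊗ H)) ≫
          (α_ (N ⊗ H) H H).inv ≫ ((α_ N H H).hom ≫ contract p H) ▷ H ≫ μ[H] := by
      rw [← hR.coact_contract hp hs]
      monoidal
    _ = ((r ≫ i ▷ H) ▷ H) ▷ H ≫ diagAct (antipodeAction l) ▷ H ≫ (α_ N H H).hom ≫
          contract p H := by
      rw [whisker_exchange, hp.diagAct_contract hs hl]
      simp
    _ = _ := by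
      have h := diagAct_comp (antipodeAction_comp hlR)
      rw [Category.assoc, h]
      simp only [comp_whiskerRight, Category.assoc]

theorem IsRationalSubmodule.isHopfModule (hR : IsRationalSubmodule p i a r)
    (hp : IsFaithfulQuasiDual H N p) (hs : (β_ H H).hom = (β_ H H).inv)
    {l : H ⊗ N ⟶ N} (hl : IsHit p l) {lR : H ⊗ R ⟶ R} (hlR : lR ≫ i = H ◁ i ≫ l) :
    IsHopfModule H R (antipodeAction lR) r where
  act_one := by
    have := hR.mono
    rw [← cancel_mono i, Category.assoc, antipodeAction_comp hlR, whisker_exchange_assoc,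
      hp.antipodeAction_one hs hl, rightUnitor_naturality]
  act_mul := by
    have := hR.mono
    rw [← cancel_mono i]
    simp only [Category.assoc]
    rw [antipodeAction_comp hlR, ← comp_whiskerRight_assoc, antipodeAction_comp hlR,
      comp_whiskerRight_assoc, hp.antipodeAction_mul hs hl, whisker_exchange_assoc]
    simp
  coact_counit := hR.mcom.coact_counit hp.toIsQuasiDual hR.isLeftModule
  coact_comul := hR.mcom.coact_comul hp hR.isLeftModule
  act_coact := by
    rw [hR.act_coact hp hs hl hlR, diagAct, MonoidalCategory.tensorHom_def r, Category.assoc]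

end Compatibility

section FundamentalTheorem

variable {C : Type u} [Category.{v} C] [MonoidalCategory C] [BraidedCategory C]

theorem isHopfModule_free (H V : C) [HopfObj H] :
    IsHopfModule H (V ⊗ H) (freeAct H V) (freeCoact H V) where
  act_one := by
    calc
      _ = 𝟙 _ ⊗≫ V ◁ (H ◁ η[H] ≫ μ[H]) := by
        rw [freeAct]
        monoidal
      _ = _ := by
        rw [MonObj.mul_one]
        monoidal
  act_mul := by
    calc
      _ = 𝟙 _ ⊗≫ V ◁ (μ[H] ▷ H ≫ μ[H]) := by
        rw [freeAct]
        monoidal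
      _ = _ := by
        rw [MonObj.mul_assoc, freeAct]
        monoidal
  coact_counit := by
    calc
      _ = V ◁ (Δ[H] ≫ H ◁ ε[H]) ⊗≫ 𝟙 _ := by
        rw [freeCoact]
        monoidal
      _ = _ := by
        rw [ComonObj.comul_counit]
        monoidal
  coact_comul := by
    calc
      _ = V ◁ (Δ[H] ≫ H ◁ Δ[H]) ⊗≫ 𝟙 _ := by
        rw [freeCoact]
        monoidal
      _ = _ := by
        rw [ComonObj.comul_assoc, freeCoact]
        monoidal
  act_coact := by
    calc
      _ = 𝟙 _ ⊗≫ V ◁ (μ[H] ≫ Δ[H]) ⊗≫ 𝟙 _ := by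
        rw [freeAct, freeCoact]
        monoidal
      _ = _ := by
        rw [BimonObj.mul_comul]
        simp only [freeAct, freeCoact, tensorμ, MonoidalCategory.tensorHom_def]
        monoidal

variable {H X : C} [HopfObj H] {a : X ⊗ H ⟶ X} {c : X ⟶ X ⊗ H}

/-- The map `t`, viewed as a generalized element of a right `H`-comodule `(X, c)`, is coinvariant:
`c(t) = t ⊗ 1`. -/
def IsCoinvariant {U : C} (c : X ⟶ X ⊗ H) (t : U ⟶ X) : Prop :=
  t ≫ c = t ≫ (ρ_ X).inv ≫ X ◁ η[H]

/-- `j : J ⟶ X` is the object of coinvariants of the comodule `(X, c)`. -/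
structure IsCoinvariants {J : C} (c : X ⟶ X ⊗ H) (j : J ⟶ X) : Prop where
  mono : Mono j
  isCoinvariant : IsCoinvariant c j
  exists_lift : ∀ {U : C} (t : U ⟶ X), IsCoinvariant c t → ∃ s : U ⟶ J, s ≫ j = t

/-- The projection `x ↦ x₀ S(x₁)` of a Hopf module onto its coinvariants. -/
def coinvariantProj (a : X ⊗ H ⟶ X) (c : X ⟶ X ⊗ H) : X ⟶ X := c ≫ X ◁ 𝒮[H] ≫ a

theorem one_diagAct (a : X ⊗ H ⟶ X) :
    ((ρ_ X).inv ≫ X ◁ η[H]) ▷ H ≫ diagAct a = X ◁ Δ[H] ≫ (α_ X H H).inv ≫ a ▷ H := by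
  calc
    _ = X ◁ Δ[H] ⊗≫ X ◁ (η[H] ▷ H ≫ (β_ H H).hom) ▷ H ⊗≫ a ▷ (H ⊗ H) ≫ X ◁ μ[H] := by
      rw [diagAct, ← whisker_exchange_assoc, tensorμ, MonoidalCategory.tensorHom_def]
      monoidal
    _ = X ◁ Δ[H] ⊗≫ ((X ⊗ H) ◁ η[H] ▷ H ≫ a ▷ (H ⊗ H)) ≫ X ◁ μ[H] := by
      rw [braiding_naturality_left, braiding_tensorUnit_left]
      monoidal
    _ = X ◁ Δ[H] ⊗≫ a ▷ H ⊗≫ X ◁ (η[H] ▷ H ≫ μ[H]) := by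
      rw [whisker_exchange]
      monoidal
    _ = _ := by
      rw [MonObj.one_mul]
      monoidal

variable (H) in
theorem comul_antipode_comul_braiding_mul :
    Δ[H] ≫ H ◁ (𝒮[H] ≫ Δ[H]) ≫ (α_ H H H).inv ≫ (β_ H H).hom ▷ H ≫ (α_ H H H).hom ≫ H ◁ μ[H] =
      𝒮[H] ≫ (ρ_ H).inv ≫ H ◁ η[H] := by
  calc
    _ = Δ[H] ≫ H ◁ Δ[H] ⊗≫ H ◁ (β_ H H).hom ⊗≫
          ((H ⊗ H) ◁ 𝒮[H] ≫ (H ◁ 𝒮[H] ≫ (β_ H H).hom) ▷ H) ⊗≫ H ◁ μ[H] := by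
      rw [antipode_comul, tensorHom_def']
      monoidal
    _ = (Δ[H] ≫ H ◁ Δ[H]) ≫ (α_ H H H).inv ≫ (β_ (H ⊗ H) H).hom ≫
          𝒮[H] ▷ (H ⊗ H) ≫ H ◁ (H ◁ 𝒮[H] ≫ μ[H]) := by
      rw [whisker_exchange, braiding_naturality_right, braiding_tensor_left_hom]
      monoidal
    _ = Δ[H] ≫ (Δ[H] ▷ H ≫ (β_ (H ⊗ H) H).hom) ≫ H ◁ (H ◁ 𝒮[H] ≫ μ[H]) ≫ 𝒮[H] ▷ H := by
      rw [ComonObj.comul_assoc, whisker_exchange]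
      simp only [Category.assoc, Iso.hom_inv_id_assoc]
    _ = Δ[H] ≫ ((β_ H H).hom ≫ H ◁ ε[H]) ≫ H ◁ η[H] ≫ 𝒮[H] ▷ H := by
      rw [braiding_naturality_left, Category.assoc, ← whiskerLeft_comp_assoc, antipode_right]
      simp only [whiskerLeft_comp, Category.assoc]
    _ = (ρ_ H).inv ≫ H ◁ η[H] ≫ 𝒮[H] ▷ H := by
      rw [← braiding_naturality_left, Category.assoc, ComonObj.counit_comul_assoc]
      simp
    _ = _ := by
      rw [whisker_exchange]
      simp

namespace IsHopfModule

theorem act_coact_eq_diagAct (hX : IsHopfModule H X a c) : a ≫ c = c ▷ H ≫ diagAct a := by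
  rw [hX.act_coact, MonoidalCategory.tensorHom_def, Category.assoc, diagAct]

theorem coact_coinvariantProj_act (hX : IsHopfModule H X a c) :
    c ≫ coinvariantProj a c ▷ H ≫ a = 𝟙 X := by
  calc
    _ = (c ≫ c ▷ H ≫ (α_ X H H).hom) ≫ (α_ X H H).inv ≫ (X ◁ 𝒮[H]) ▷ H ≫ a ▷ H ≫ a := by
      simp [coinvariantProj]
    _ = c ≫ X ◁ (Δ[H] ≫ 𝒮[H] ▷ H ≫ μ[H]) ≫ a := by
      rw [← hX.coact_comul, hX.act_mul]
      monoidal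
    _ = (c ≫ X ◁ ε[H]) ≫ X ◁ η[H] ≫ a := by
      rw [antipode_left]
      simp
    _ = _ := by
      rw [hX.coact_counit, hX.act_one, Iso.inv_hom_id]

theorem isCoinvariant_coinvariantProj (hX : IsHopfModule H X a c) :
    IsCoinvariant c (coinvariantProj a c) := by
  calc
    _ = c ≫ (X ◁ 𝒮[H] ≫ c ▷ H) ≫ diagAct a := by
      simp [coinvariantProj, hX.act_coact_eq_diagAct]
    _ = (c ≫ X ◁ Δ[H]) ≫ (α_ X H H).inv ≫ (X ⊗ H) ◁ 𝒮[H] ≫ diagAct a := by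
      rw [whisker_exchange, hX.coact_comul]
      simp
    _ = c ⊗≫ X ◁ (Δ[H] ≫ H ◁ (𝒮[H] ≫ Δ[H]) ≫ (α_ H H H).inv ≫ (β_ H H).hom ▷ H ≫
          (α_ H H H).hom ≫ H ◁ μ[H]) ⊗≫ a ▷ H := by
      rw [diagAct, tensorμ, tensorHom_def']
      monoidal
    _ = (c ≫ X ◁ 𝒮[H]) ⊗≫ (a ▷ 𝟙_ C ≫ X ◁ η[H]) := by
      rw [comul_antipode_comul_braiding_mul, ← whisker_exchange]
      monoidal
    _ = _ := by
      rw [coinvariantProj]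
      monoidal

end IsHopfModule

theorem IsHopfModule.isCoinvariant_iff (hX : IsHopfModule H X a c) {U : C} {t : U ⟶ X} :
    IsCoinvariant c t ↔ t ≫ coinvariantProj a c = t where
  mp ht := by
    have ht' : t ≫ c = t ≫ (ρ_ X).inv ≫ X ◁ η[H] := ht
    rw [coinvariantProj, reassoc_of% ht', ← whiskerLeft_comp_assoc, one_antipode, hX.act_one,
      Iso.inv_hom_id, Category.comp_id]
  mpr ht := by
    have hP : coinvariantProj a c ≫ c = coinvariantProj a c ≫ (ρ_ X).inv ≫ X ◁ η[H] :=
      hX.isCoinvariant_coinvariantProj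
    rw [IsCoinvariant, ← ht, Category.assoc, Category.assoc, hP]

namespace IsCoinvariant

variable {U : C} {t : U ⟶ X}

theorem act_coact (ht : IsCoinvariant c t) (hX : IsHopfModule H X a c) :
    t ▷ H ≫ a ≫ c = t ▷ H ≫ X ◁ Δ[H] ≫ (α_ X H H).inv ≫ a ▷ H := by
  have ht' : t ≫ c = t ≫ (ρ_ X).inv ≫ X ◁ η[H] := ht
  rw [hX.act_coact_eq_diagAct, ← comp_whiskerRight_assoc, ht', comp_whiskerRight_assoc,
    one_diagAct]

theorem act_coinvariantProj (ht : IsCoinvariant c t) (hX : IsHopfModule H X a c) :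
    t ▷ H ≫ a ≫ coinvariantProj a c = U ◁ ε[H] ≫ (ρ_ U).hom ≫ t := by
  calc
    _ = (t ▷ H ≫ a ≫ c) ≫ X ◁ 𝒮[H] ≫ a := by simp [coinvariantProj]
    _ = t ▷ H ≫ X ◁ Δ[H] ≫ (α_ X H H).inv ≫ (X ⊗ H) ◁ 𝒮[H] ≫ a ▷ H ≫ a := by
      rw [ht.act_coact hX, whisker_exchange_assoc]
      simp
    _ = t ▷ H ≫ X ◁ (Δ[H] ≫ H ◁ 𝒮[H] ≫ μ[H]) ≫ a := by
      rw [hX.act_mul]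
      monoidal
    _ = (t ▷ H ≫ X ◁ ε[H]) ≫ X ◁ η[H] ≫ a := by
      rw [antipode_right]
      simp
    _ = _ := by
      rw [← whisker_exchange, hX.act_one]
      simp

end IsCoinvariant

namespace IsHopfModule

variable {J : C} {j : J ⟶ X} {q : X ⟶ J}

theorem isCoinvariants_of_split (hX : IsHopfModule H X a c) (hjq : j ≫ q = 𝟙 J)
    (hqj : q ≫ j = coinvariantProj a c) : IsCoinvariants c j where
  mono := mono_of_mono_fac hjq
  isCoinvariant := hX.isCoinvariant_iff.2 (by rw [← hqj, reassoc_of% hjq])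
  exists_lift t ht := ⟨t ≫ q, by rw [Category.assoc, hqj, hX.isCoinvariant_iff.1 ht]⟩

/-- The isomorphism `x ↦ x₀ S(x₁) ⊗ x₂` of a Hopf module with the free one on its coinvariants, the
latter given by a splitting `q ≫ j` of the projection; its inverse is `y ⊗ h ↦ y h`. -/
def isoFree (hX : IsHopfModule H X a c) (hjq : j ≫ q = 𝟙 J) (hqj : q ≫ j = coinvariantProj a c) :
    X ≅ J ⊗ H where
  hom := c ≫ q ▷ H
  inv := j ▷ H ≫ a
  hom_inv_id := by
    rw [Category.assoc, ← comp_whiskerRight_assoc, hqj, hX.coact_coinvariantProj_act]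
  inv_hom_id := by
    have hj := (hX.isCoinvariants_of_split hjq hqj).isCoinvariant
    have hq : q = coinvariantProj a c ≫ q := by rw [← hqj, Category.assoc, hjq, Category.comp_id]
    calc
      _ = (j ▷ H ≫ a ≫ c) ≫ q ▷ H := by simp
      _ = (j ▷ H ≫ X ◁ Δ[H]) ⊗≫ (a ≫ coinvariantProj a c ≫ q) ▷ H := by
        rw [hj.act_coact hX, ← hq]
        monoidal
      _ = J ◁ Δ[H] ⊗≫ (j ▷ H ≫ a ≫ coinvariantProj a c) ▷ H ≫ q ▷ H := by
        rw [← whisker_exchange]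
        monoidal
      _ = J ◁ (Δ[H] ≫ ε[H] ▷ H) ⊗≫ (j ≫ q) ▷ H := by
        rw [hj.act_coinvariantProj hX]
        monoidal
      _ = _ := by
        rw [ComonObj.counit_comul, hjq]
        monoidal

theorem act_isoFree_hom (hX : IsHopfModule H X a c) (hjq : j ≫ q = 𝟙 J)
    (hqj : q ≫ j = coinvariantProj a c) :
    a ≫ (hX.isoFree hjq hqj).hom = (hX.isoFree hjq hqj).hom ▷ H ≫ freeAct H J := by
  have h : freeAct H J ≫ (hX.isoFree hjq hqj).inv = (hX.isoFree hjq hqj).inv ▷ H ≫ a := by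
    rw [isoFree, freeAct, comp_whiskerRight, Category.assoc, Category.assoc, hX.act_mul,
      whisker_exchange_assoc, associator_naturality_left_assoc]
  rw [← cancel_mono (hX.isoFree hjq hqj).inv, Category.assoc, Category.assoc, h]
  simp

theorem coact_isoFree_hom (hX : IsHopfModule H X a c) (hjq : j ≫ q = 𝟙 J)
    (hqj : q ≫ j = coinvariantProj a c) :
    c ≫ (hX.isoFree hjq hqj).hom ▷ H = (hX.isoFree hjq hqj).hom ≫ freeCoact H J := by
  calc
    _ = (c ≫ c ▷ H ≫ (α_ X H H).hom) ≫ q ▷ (H ⊗ H) ≫ (α_ J H H).inv := by simp [isoFree]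
    _ = c ≫ (X ◁ Δ[H] ≫ q ▷ (H ⊗ H)) ≫ (α_ J H H).inv := by
      rw [← hX.coact_comul]
      simp only [Category.assoc]
    _ = _ := by
      rw [whisker_exchange, isoFree, freeCoact]
      simp only [Category.assoc]

theorem exists_iso_free [IsIdempotentComplete C] (hX : IsHopfModule H X a c) :
    ∃ (J : C) (j : J ⟶ X), IsCoinvariants c j ∧
      ∃ φ : X ≅ J ⊗ H, a ≫ φ.hom = φ.hom ▷ H ≫ freeAct H J ∧
        c ≫ φ.hom ▷ H = φ.hom ≫ freeCoact H J := by
  obtain ⟨J, j, q, hjq, hqj⟩ := IsIdempotentComplete.idempotents_split X (coinvariantProj a c)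
    (hX.isCoinvariant_iff.1 hX.isCoinvariant_coinvariantProj)
  exact ⟨J, j, hX.isCoinvariants_of_split hjq hqj, hX.isoFree hjq hqj,
    hX.act_isoFree_hom hjq hqj, hX.coact_isoFree_hom hjq hqj⟩

end IsHopfModule

end FundamentalTheorem

section Integrals

section Evaluation

variable {C : Type u} [Category.{v} C] [MonoidalCategory C] {H N : C} [MonObj H]

/-- Evaluation at the unit, `n ↦ ⟨n, 1⟩` -/
def evalOne (p : N ⊗ H ⟶ 𝟙_ C) : N ⟶ 𝟙_ C := (ρ_ N).inv ≫ N ◁ η[H] ≫ p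

/-- The map `f`, viewed as a generalized element of the algebra `N`, is a left integral:
`n * f = ⟨n, 1⟩ f`. -/
def IsLeftIntegral [MonObj N] (p : N ⊗ H ⟶ 𝟙_ C) {U : C} (f : U ⟶ N) : Prop :=
  N ◁ f ≫ μ[N] = evalOne p ▷ U ≫ (λ_ U).hom ≫ f

theorem isLeftModule_of_mono [MonObj N] {U : C} (f : U ⟶ N) [Mono f] {b : N ⊗ U ⟶ U}
    (hb : b ≫ f = N ◁ f ≫ μ[N]) : IsLeftModule N U b where
  one_act := by
    rw [← cancel_mono f, Category.assoc, hb, ← whisker_exchange_assoc, MonObj.one_mul,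
      leftUnitor_naturality]
  mul_act := by
    rw [← cancel_mono f]
    simp only [Category.assoc]
    rw [hb, ← whisker_exchange_assoc, MonObj.mul_assoc, ← whiskerLeft_comp_assoc, hb]
    simp

variable [BraidedCategory C]

theorem contract_one (p : N ⊗ H ⟶ 𝟙_ C) (U : C) :
    N ◁ ((ρ_ U).inv ≫ U ◁ η[H]) ≫ contract p U = evalOne p ▷ U ≫ (λ_ U).hom := by
  calc
    _ = N ◁ ((ρ_ U).inv ≫ U ◁ η[H] ≫ (β_ H U).inv) ≫ (α_ N H U).inv ≫ p ▷ U ≫ (λ_ U).hom := by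
      rw [contract_eq]
      monoidal
    _ = N ◁ ((λ_ U).inv ≫ η[H] ▷ U) ≫ (α_ N H U).inv ≫ p ▷ U ≫ (λ_ U).hom := by
      rw [braiding_inv_naturality_right, braiding_inv_tensorUnit_left]
      simp
    _ = _ := by
      rw [evalOne]
      monoidal

theorem IsLeftIntegral.isRationalSubmodule [MonObj N] {p : N ⊗ H ⟶ 𝟙_ C} {U : C} {f : U ⟶ N}
    [Mono f] (hf : IsLeftIntegral p f) :
    IsRationalSubmodule p f (evalOne p ▷ U ≫ (λ_ U).hom) ((ρ_ U).inv ≫ U ◁ η[H]) where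
  mono := inferInstance
  isLeftModule := isLeftModule_of_mono f ((Category.assoc _ _ _).trans hf.symm)
  act_comp := (Category.assoc _ _ _).trans hf.symm
  mcom := contract_one p U

end Evaluation

section Coinvariants

variable {C : Type u} [Category.{v} C] [MonoidalCategory C] [BraidedCategory C]
  {H N R : C} [HopfObj H] [MonObj N] {p : N ⊗ H ⟶ 𝟙_ C}
  {i : R ⟶ N} {a : N ⊗ R ⟶ R} {r : R ⟶ R ⊗ H}

theorem IsRationalSubmodule.isCoinvariant_iff (hR : IsRationalSubmodule p i a r)
    (hp : IsFaithfulQuasiDual H N p) {U : C} {t : U ⟶ R} :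
    IsCoinvariant r t ↔ IsLeftIntegral p (t ≫ i) := by
  have hr : N ◁ r ≫ contract p R = a := hR.mcom
  have := hR.mono
  have h₁ : (N ◁ (t ≫ r) ≫ contract p R) ≫ i = N ◁ (t ≫ i) ≫ μ[N] := by
    rw [whiskerLeft_comp_assoc, hr, Category.assoc, hR.act_comp, whiskerLeft_comp_assoc]
  have h₂ : (N ◁ (t ≫ (ρ_ R).inv ≫ R ◁ η[H]) ≫ contract p R) ≫ i =
      evalOne p ▷ U ≫ (λ_ U).hom ≫ t ≫ i := by
    rw [whiskerLeft_comp_assoc, contract_one, whisker_exchange_assoc, leftUnitor_naturality]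
    simp only [Category.assoc]
  rw [IsLeftIntegral, ← h₁, ← h₂, cancel_mono]
  exact ⟨fun h ↦ by rw [h], hp.hom_ext_contract⟩

end Coinvariants

section Elements

variable {k : Type w} [Field k] {C : Type u} [Category.{v} C] [MonoidalCategory C]
  (F : C ⥤ ModuleCat.{w} k) [F.Monoidal] {H N : C} [MonObj H]

theorem toDual_oneElt (p : N ⊗ H ⟶ 𝟙_ C) (g : F.obj N) :
    toDual F p g (oneElt F H) = (F.map (evalOne p) ≫ Functor.OplaxMonoidal.η F).hom g := by
  have h : F.obj N ◁ (Functor.LaxMonoidal.ε F ≫ F.map η[H]) ≫ Functor.LaxMonoidal.μ F N H ≫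
      F.map p = (ρ_ (F.obj N)).hom ≫ F.map (evalOne p) := by
    rw [Functor.LaxMonoidal.right_unitality, evalOne]
    simp only [whiskerLeft_comp, Category.assoc, ← Functor.map_comp, Iso.hom_inv_id_assoc]
    rw [Functor.LaxMonoidal.μ_natural_right_assoc, ← Functor.map_comp]
  calc
    _ = (Functor.OplaxMonoidal.η F).hom
          (((ρ_ (F.obj N)).hom ≫ F.map (evalOne p)).hom (g ⊗ₜ[k] (1 : k))) := by
      rw [← h]
      rfl
    _ = (Functor.OplaxMonoidal.η F).hom ((F.map (evalOne p)).hom ((1 : k) • g)) := rfl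
    _ = _ := by
      rw [one_smul]
      rfl

theorem map_whiskerRight_leftUnitor (e : N ⟶ 𝟙_ C) {U : C} (g : F.obj N) (x : F.obj U) :
    (Functor.LaxMonoidal.μ F N U ≫ F.map (e ▷ U ≫ (λ_ U).hom)).hom (g ⊗ₜ[k] x) =
      (show k from (F.map e ≫ Functor.OplaxMonoidal.η F).hom g) • x := by
  have h : Functor.LaxMonoidal.μ F N U ≫ F.map (e ▷ U ≫ (λ_ U).hom) =
      (F.map e ≫ Functor.OplaxMonoidal.η F) ▷ F.obj U ≫ (λ_ (F.obj U)).hom := by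
    rw [Functor.LaxMonoidal.left_unitality, Functor.map_comp,
      ← Functor.LaxMonoidal.μ_natural_left_assoc, comp_whiskerRight_assoc,
      ← comp_whiskerRight_assoc (Functor.OplaxMonoidal.η F), Functor.Monoidal.η_ε,
      id_whiskerRight, Category.id_comp]
  rw [h]
  rfl

theorem map_evalOne_whiskerRight (p : N ⊗ H ⟶ 𝟙_ C) {U V : C} (f : U ⟶ V) (g : F.obj N)
    (x : F.obj U) :
    (Functor.LaxMonoidal.μ F N U ≫ F.map (evalOne p ▷ U ≫ (λ_ U).hom ≫ f)).hom (g ⊗ₜ[k] x) =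
      toDual F p g (oneElt F H) • (F.map f).hom x := by
  rw [toDual_oneElt, ← Category.assoc (evalOne p ▷ U), Functor.map_comp, ← Category.assoc,
    ModuleCat.hom_comp, LinearMap.comp_apply, map_whiskerRight_leftUnitor, map_smul]

variable [MonObj N] (p : N ⊗ H ⟶ 𝟙_ C) {U : C} (f : U ⟶ N)

theorem map_whiskerLeft_mul (g : F.obj N) (x : F.obj U) :
    (Functor.LaxMonoidal.μ F N U ≫ F.map (N ◁ f ≫ μ[N])).hom (g ⊗ₜ[k] x) =
      mulElt F g ((F.map f).hom x) := by
  rw [Functor.map_comp, ← Functor.LaxMonoidal.μ_natural_right_assoc]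
  rfl

theorem range_subset_leftIntegrals_iff [F.Faithful] :
    Set.range (F.map f).hom ⊆ leftIntegrals F p ↔ IsLeftIntegral p f where
  mp h := by
    apply F.map_injective
    rw [← cancel_epi (Functor.LaxMonoidal.μ F N U)]
    refine ModuleCat.hom_ext (TensorProduct.ext' fun g x ↦ ?_)
    rw [map_whiskerLeft_mul, map_evalOne_whiskerRight]
    exact h ⟨x, rfl⟩ g
  mpr h := by
    rintro _ ⟨x, rfl⟩ g
    rw [← map_whiskerLeft_mul, h, map_evalOne_whiskerRight]

variable {F p} in
theorem IsIntegralObject.range_eq_leftIntegrals [F.Faithful] {J T : C} {e : J ⟶ N}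
    (he : IsIntegralObject F p e) {t : T ⟶ N} (ht : Function.Injective (F.map t).hom)
    (hrange : Set.range (F.map t).hom = leftIntegrals F p) :
    Set.range (F.map e).hom = leftIntegrals F p := by
  have ht_mono : Mono t := F.mono_of_mono_map ((ModuleCat.mono_iff_injective _).2 ht)
  obtain ⟨s, rfl⟩ := he.greatest t ht_mono hrange.subset
  refine he.range_subset.antisymm (hrange.ge.trans ?_)
  rintro _ ⟨x, rfl⟩
  exact ⟨(F.map s).hom x, by simp⟩

end Elements

theorem IsMaximalRationalSubmodule.isIntegralObject {k : Type w} [Field k] {C : Type u}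
    [Category.{v} C] [MonoidalCategory C] [BraidedCategory C] (F : C ⥤ ModuleCat.{w} k)
    [F.Monoidal] [F.Faithful] {H N R J : C} [HopfObj H] [MonObj N] {p : N ⊗ H ⟶ 𝟙_ C}
    {i : R ⟶ N} {a : N ⊗ R ⟶ R} {r : R ⟶ R ⊗ H} {j : J ⟶ R}
    (hR : IsMaximalRationalSubmodule p i a r) (hp : IsFaithfulQuasiDual H N p)
    (hj : IsCoinvariants r j) : IsIntegralObject F p (j ≫ i) where
  mono := by
    have := hR.mono
    have := hj.mono
    exact mono_comp j i
  range_subset := (range_subset_leftIntegrals_iff F p _).2 <|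
    (hR.isCoinvariant_iff hp).1 hj.isCoinvariant
  greatest f hf hrange := by
    have hint := (range_subset_leftIntegrals_iff F p f).1 hrange
    obtain ⟨t, rfl⟩ := hR.greatest f _ _ hint.isRationalSubmodule
    obtain ⟨s, rfl⟩ := hj.exists_lift t ((hR.isCoinvariant_iff hp).2 hint)
    exact ⟨s, (Category.assoc _ _ _).symm⟩

end Integrals

end BraidedIntegral

open BraidedIntegral in
theorem corollary2p2_general {k : Type w} [Field k] {C : Type u} [Category.{v} C]
    [MonoidalCategory C] [BraidedCategory C] [IsIdempotentComplete C]
    (F : C ⥤ ModuleCat.{w} k) [F.Monoidal] [F.Faithful]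
    {H : C} [HopfObj H] (hsymm : (β_ H H).hom = (β_ H H).inv)
    {Hd : C} [MonObj Hd] {p : Hd ⊗ H ⟶ 𝟙_ C} (hp : IsFaithfulQuasiDual H Hd p)
    {R : C} {i : R ⟶ Hd} {a : Hd ⊗ R ⟶ R} {r : R ⟶ R ⊗ H}
    (hR : IsMaximalRationalSubmodule p i a r)
    {l : H ⊗ Hd ⟶ Hd} (hl : IsHit p l) {lR : H ⊗ R ⟶ R} (hlR : lR ≫ i = H ◁ i ≫ l) :
    IsHopfModule H R (antipodeAction lR) r ∧
    ∃ (J : C) (e : J ⟶ Hd),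
      IsIntegralObject F p e ∧
      ((∃ (T : C) (t : T ⟶ Hd), Function.Injective (F.map t).hom ∧
          Set.range (F.map t).hom = leftIntegrals F p) →
        Set.range (F.map e).hom = leftIntegrals F p) ∧
      IsHopfModule H (J ⊗ H) (freeAct H J) (freeCoact H J) ∧
      ∃ φ : R ≅ J ⊗ H,
        antipodeAction lR ≫ φ.hom = φ.hom ▷ H ≫ freeAct H J ∧
        r ≫ φ.hom ▷ H = φ.hom ≫ freeCoact H J := by
  have hopf : IsHopfModule H R (antipodeAction lR) r := hR.isHopfModule hp hsymm hl hlR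
  obtain ⟨J, j, hj, hfree⟩ := hopf.exists_iso_free
  have he : IsIntegralObject F p (j ≫ i) := hR.isIntegralObject F hp hj
  exact ⟨hopf, J, j ≫ i, he, fun ⟨_, _, ht, hrange⟩ ↦ he.range_eq_leftIntegrals ht hrange,
    isHopfModule_free H J, hfree⟩

theorem corollary2p2 {k : Type w} [Field k] {C : Type u} [Category.{v} C]
    [MonoidalCategory C] [BraidedCategory C] [Limits.HasEqualizers C]
    (F : C ⥤ ModuleCat.{w} k) [F.Monoidal] [F.Faithful]
    (H : C) [HopfObj H] (hsymm : (β_ H H).hom = (β_ H H).inv)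
    -- the faithful quasi-dual `H^d ⊆ H^*`, with `⟨ , ⟩` the evaluation
    (Hd : C) [MonObj Hd] (p : Hd ⊗ H ⟶ 𝟙_ C)
    (hp : BraidedIntegral.IsFaithfulQuasiDual H Hd p)
    (hsub : Function.Injective (BraidedIntegral.toDual F p))
    -- the maximal rational submodule `R = H^{d rat}`
    (R : C) (i : R ⟶ Hd) (a : Hd ⊗ R ⟶ R) (r : R ⟶ R ⊗ H)
    (hR : BraidedIntegral.IsMaximalRationalSubmodule p i a r)
    -- `⇀` is a morphism of `C` and restricts to a morphism `H ⊗ R ⟶ R`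
    (l : H ⊗ Hd ⟶ Hd) (hl : BraidedIntegral.IsHit p l)
    (lR : H ⊗ R ⟶ R) (hlR : lR ≫ i = H ◁ i ≫ l) :
    BraidedIntegral.IsHopfModule H R (BraidedIntegral.antipodeAction lR) r ∧
    ∃ (J : C) (e : J ⟶ Hd),
      BraidedIntegral.IsIntegralObject F p e ∧
      -- `J` is the full set of left integrals as soon as that set underlies an object of `C`
      ((∃ (T : C) (t : T ⟶ Hd), Function.Injective (F.map t).hom ∧
          Set.range (F.map t).hom = BraidedIntegral.leftIntegrals F p) →
        Set.range (F.map e).hom = BraidedIntegral.leftIntegrals F p) ∧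
      BraidedIntegral.IsHopfModule H (J ⊗ H)
        (BraidedIntegral.freeAct H J) (BraidedIntegral.freeCoact H J) ∧
      ∃ φ : R ≅ J ⊗ H,
        BraidedIntegral.antipodeAction lR ≫ φ.hom =
          φ.hom ▷ H ≫ BraidedIntegral.freeAct H J ∧
        r ≫ φ.hom ▷ H = φ.hom ≫ BraidedIntegral.freeCoact H J := by
  have := (Idempotents.isIdempotentComplete_iff_hasEqualizer_of_id_and_idempotent C).2
    fun _ _ _ ↦ inferInstance
  exact corollary2p2_general F hsymm hp hR hl hlR
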